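/- Let $d\ge 1$, let $A\in\mathbb{R}^{d\times d}$ be symmetric, $b\in\mathbb{R}^d$ and $R>0$, and put $f(x)=\tfrac12 x^TAx+b^Tx$. Let $\lambda_{\min}$ and $\lambda_{\max}$ be the smallest and largest eigenvalues of $A$, and let $\|\cdot\|$ be the Euclidean norm. Let $s^\star$ be a global minimizer of $f$ over $\{x\in\mathbb{R}^d:\|x\|\le R\}$. Then there is a unique real number $\lambda^\star$ (the optimal Lagrange multiplier) such that $$(A+\lambda^\star I)s^\star=-b,\qquad \lambda^\star\ge\max\{-\lambda_{\min},0\},\qquad \lambda^\star(R-\|s^\star\|)=0 .$$ Moreover, for every integer $t\ge 1$ and every minimizer $s_t$ of $f$ over $\{x\in\mathcal{K}_t(A,b):\|x\|\le R\}$, where $\mathcal{K}_t(A,b)=\mathrm{span}\{b,Ab,\ldots,A^{t-1}b\}$, the following two bounds hold. 1. We have $$f(s_t)-f(s^\star)\le 36\,[f(0)-f(s^\star)]\exp\left\{-4t\sqrt{\frac{\lambda_{\min}+\lambda^\star}{\lambda_{\max}+\lambda^\star}}\right\},$$ where the quotient is read as $0$ in the degenerate case $\lambda_{\min}+\lambda^\star=\lambda_{\max}+\lambda^\star=0$.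 2. For every unit eigenvector $u_{\min}$ of $A$ with eigenvalue $\lambda_{\min}$ such that $u_{\min}^Tb\ne 0$ in case $\lambda_{\min}<0$, we have $$f(s_t)-f(s^\star)\le\frac{(\lambda_{\max}-\lambda_{\min})\|s^\star\|^2}{(t-\frac12)^2}\left[4+\frac{\mathbf{1}_{\{\lambda_{\min}<0\}}}{8}\log^2\left(\frac{4\|b\|^2}{(u_{\min}^Tb)^2}\right)\right],$$ where the term with the indicator is $0$ if $\lambda_{\min}\ge 0$. -/

import Mathlib

noncomputable section

namespace TrustRegion

variable {d : ℕ}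

/-- The quadratic `f(x) = ½ xᵀ A x + bᵀ x`. -/
def quad (A : Matrix (Fin d) (Fin d) ℝ) (b x : EuclideanSpace ℝ (Fin d)) : ℝ :=
  1 / 2 * inner ℝ x (Matrix.toEuclideanLin A x) + inner ℝ b x

/-- The Krylov subspace of order `t`, the span of `b, A b, …, A ^ (t - 1) b`. -/
def krylov (A : Matrix (Fin d) (Fin d) ℝ) (b : EuclideanSpace ℝ (Fin d)) (t : ℕ) :
    Submodule ℝ (EuclideanSpace ℝ (Fin d)) :=
  Submodule.span ℝ {x | ∃ i : ℕ, i < t ∧ x = Matrix.toEuclideanLin (A ^ i) b}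

/-- The set of (real) eigenvalues of `A`. -/
def eigenvalueSet (A : Matrix (Fin d) (Fin d) ℝ) : Set ℝ :=
  {μ | Module.End.HasEigenvalue (Matrix.toEuclideanLin A) μ}

/-- `s` is a global minimizer of `quad A b` over the ball of radius `R`. -/
structure IsSolution (A : Matrix (Fin d) (Fin d) ℝ) (b : EuclideanSpace ℝ (Fin d)) (R : ℝ)
    (s : EuclideanSpace ℝ (Fin d)) : Prop where
  norm_le : ‖s‖ ≤ R
  le_of_norm_le : ∀ x, ‖x‖ ≤ R → quad A b s ≤ quad A b x

/-- `s` is a minimizer of `quad A b` over the part of the ball of radius `R` that lies in the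
Krylov subspace of order `t`. -/
structure IsKrylovSolution (A : Matrix (Fin d) (Fin d) ℝ) (b : EuclideanSpace ℝ (Fin d)) (R : ℝ)
    (t : ℕ) (s : EuclideanSpace ℝ (Fin d)) : Prop where
  mem : s ∈ krylov A b t
  norm_le : ‖s‖ ≤ R
  le_of_mem : ∀ x ∈ krylov A b t, ‖x‖ ≤ R → quad A b s ≤ quad A b x

/-- `lam` is an optimal Lagrange multiplier for the solution `s`, where `lmin` is the smallest
eigenvalue of `A`: `(A + lam I) s = -b`, `lam ≥ max (-lmin) 0` and `lam (R - ‖s‖) = 0`. -/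
structure IsMultiplier (A : Matrix (Fin d) (Fin d) ℝ) (b : EuclideanSpace ℝ (Fin d)) (R lmin : ℝ)
    (s : EuclideanSpace ℝ (Fin d)) (lam : ℝ) : Prop where
  stationary : Matrix.toEuclideanLin (A + lam • (1 : Matrix (Fin d) (Fin d) ℝ)) s = -b
  ge : max (-lmin) 0 ≤ lam
  complementary : lam * (R - ‖s‖) = 0

end TrustRegion

end

open Polynomial

namespace TrustRegion

/-! The first-order condition on the ball yields a multiplier λ, and comparing `s` with its
reflections on the sphere (or with a segment, if `s` is interior) shows λ ≥ -λ_min. Completing the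
square then gives f(x) - f(s) = ½⟨x - s, (A + λ)(x - s)⟩ + (λ/2)(‖s‖² - ‖x‖²). Since `st` is optimal
in the Krylov space, each rate only needs one good feasible Krylov vector.

Linear rate (`krylovSpan_linear_rate`): if p(0) = 1 and deg p ≤ t, then y = s - p(A + λ)s lies in
the Krylov space, because (A + λ)s = -b. A shifted Chebyshev polynomial of the first kind makes y
close to `s`, both in norm and in the (A + λ)-seminorm. Rescaling y to norm ‖s‖ removes the
multiplier term (`inner_rescale_sub_le`).

Sublinear rate (`krylovSpan_sublinear_rate`): accelerated proximal gradient stays in the Krylov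
spaces, because the proximal map of the ball only rescales vectors (`exists_smul_prox`). This
settles λ_min ≥ 0. If λ_min < 0, the method is applied to the convex function f - (λ_min/2)‖x‖², and
its output x is moved to the sphere, where the two functions differ by a constant. The move follows
a Krylov vector of nearly minimal curvature, built from Chebyshev polynomials of the fourth kind
(`exists_mem_krylovSpan_inner_le`). -/

/-! ### Extremal polynomials of Chebyshev type -/

theorem le_artanh {z : ℝ} (h0 : 0 ≤ z) (h1 : z < 1) : z ≤ Real.artanh z := by
  have hs := Real.hasSum_log_sub_log_of_abs_lt_one (x := z) (by rwa [abs_of_nonneg h0])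
  have h := le_hasSum hs 0 fun k _ => by positivity
  rw [Real.artanh_eq_half_log ⟨by linarith, h1.le⟩, Real.log_div (by linarith) (by linarith)]
  norm_num at h
  linarith

theorem cosh_two_mul_artanh {z : ℝ} (h0 : 0 ≤ z) (h1 : z < 1) :
    Real.cosh (2 * Real.artanh z) = (1 + z ^ 2) / (1 - z ^ 2) := by
  have hz : z ∈ Set.Ioo (-1 : ℝ) 1 := ⟨by linarith, h1⟩
  have hpos : 0 < 1 - z ^ 2 := by nlinarith
  rw [Real.cosh_two_mul, Real.cosh_artanh hz, Real.sinh_artanh hz, div_pow, div_pow,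
    Real.sq_sqrt hpos.le]
  ring

/-- The Chebyshev polynomials of the fourth kind. -/
noncomputable def chebyshevW (n : ℕ) : ℝ[X] := Chebyshev.U ℝ n + Chebyshev.U ℝ ((n : ℤ) - 1)

theorem natDegree_chebyshevW_le (n : ℕ) : (chebyshevW n).natDegree ≤ n := by
  refine natDegree_add_le_of_degree_le ?_ ?_
  · simp
  · rw [Chebyshev.natDegree_U]
    omega

theorem eval_chebyshevW_zero (y : ℝ) : (chebyshevW 0).eval y = 1 := by
  simp [chebyshevW]

theorem eval_chebyshevW_one (y : ℝ) : (chebyshevW 1).eval y = 2 * y + 1 := by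
  simp [chebyshevW]

theorem eval_chebyshevW_add_two (n : ℕ) (y : ℝ) :
    (chebyshevW (n + 2)).eval y =
      2 * y * (chebyshevW (n + 1)).eval y - (chebyshevW n).eval y := by
  have h1 := congrArg (eval y) (Chebyshev.U_add_two ℝ (n : ℤ))
  have h2 := congrArg (eval y) (Chebyshev.U_add_two ℝ ((n : ℤ) - 1))
  have e1 : (n : ℤ) - 1 + 2 = n + 2 - 1 := by ring
  have e2 : (n : ℤ) - 1 + 1 = n + 1 - 1 := by ring
  rw [e1, e2] at h2
  simp only [eval_sub, eval_mul, eval_X, eval_ofNat] at h1 h2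
  simp only [chebyshevW, eval_add, Nat.cast_add, Nat.cast_ofNat, Nat.cast_one, h1, h2]
  ring

/-- The three-term recurrence is the addition formula for the sine with step 2a. Keeping sin a as a
factor avoids a division. -/
theorem eval_chebyshevW_cos (n : ℕ) (a : ℝ) :
    (chebyshevW n).eval (Real.cos (2 * a)) * Real.sin a = Real.sin ((2 * n + 1) * a) := by
  induction n using Nat.twoStepInduction with
  | zero => simp [eval_chebyshevW_zero]
  | one =>
    rw [eval_chebyshevW_one, show (2 * ((1 : ℕ) : ℝ) + 1) * a = 3 * a by push_cast; ring,
      Real.sin_three_mul, Real.cos_two_mul, Real.cos_sq']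
    ring
  | more n ih0 ih1 =>
    rw [eval_chebyshevW_add_two, sub_mul, mul_assoc, ih0, ih1]
    have e1 : (2 * ((n + 2 : ℕ) : ℝ) + 1) * a = (2 * ((n + 1 : ℕ) : ℝ) + 1) * a + 2 * a := by
      push_cast; ring
    have e2 : (2 * (n : ℝ) + 1) * a = (2 * ((n + 1 : ℕ) : ℝ) + 1) * a - 2 * a := by
      push_cast; ring
    rw [e1, e2, Real.sin_add, Real.sin_sub]
    ring

theorem eval_chebyshevW_cosh (n : ℕ) (a : ℝ) :
    (chebyshevW n).eval (Real.cosh (2 * a)) * Real.sinh a = Real.sinh ((2 * n + 1) * a) := by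
  induction n using Nat.twoStepInduction with
  | zero => simp [eval_chebyshevW_zero]
  | one =>
    rw [eval_chebyshevW_one, show (2 * ((1 : ℕ) : ℝ) + 1) * a = 3 * a by push_cast; ring,
      Real.sinh_three_mul, Real.cosh_two_mul, Real.cosh_sq']
    ring
  | more n ih0 ih1 =>
    rw [eval_chebyshevW_add_two, sub_mul, mul_assoc, ih0, ih1]
    have e1 : (2 * ((n + 2 : ℕ) : ℝ) + 1) * a = (2 * ((n + 1 : ℕ) : ℝ) + 1) * a + 2 * a := by
      push_cast; ring
    have e2 : (2 * (n : ℝ) + 1) * a = (2 * ((n + 1 : ℕ) : ℝ) + 1) * a - 2 * a := by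
      push_cast; ring
    rw [e1, e2, Real.sinh_add, Real.sinh_sub]
    ring

/-- With y = cos 2a one has 1 - y = 2 sin² a, so the left side is exactly 2 sin²((2n + 1)a). -/
theorem one_sub_mul_eval_chebyshevW_sq_le (n : ℕ) {y : ℝ} (h0 : -1 ≤ y) (h1 : y ≤ 1) :
    (1 - y) * (chebyshevW n).eval y ^ 2 ≤ 2 := by
  have h := eval_chebyshevW_cos n (Real.arccos y / 2)
  have hy : Real.cos (2 * (Real.arccos y / 2)) = y := by
    rw [mul_div_cancel₀ _ two_ne_zero, Real.cos_arccos h0 h1]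
  have hs : 1 - y = 2 * Real.sin (Real.arccos y / 2) ^ 2 := by
    rw [Real.cos_two_mul, Real.cos_sq'] at hy; linarith
  rw [hy] at h
  calc (1 - y) * (chebyshevW n).eval y ^ 2
      = 2 * ((chebyshevW n).eval y * Real.sin (Real.arccos y / 2)) ^ 2 := by rw [hs]; ring
    _ ≤ 2 := by rw [h]; linarith [Real.sin_sq_le_one ((2 * n + 1) * (Real.arccos y / 2))]

/-- A polynomial of degree at most `t` with value `1` at `0` that is exponentially small on a
positive interval. -/
theorem exists_polynomial_abs_le_exp (t : ℕ) {m M : ℝ} (hm : 0 < m) (hmM : m < M) :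
    ∃ p : ℝ[X], p.natDegree ≤ t ∧ p.eval 0 = 1 ∧
      ∀ x, m ≤ x → x ≤ M → |p.eval x| ≤ 2 * Real.exp (-2 * t * √(m / M)) := by
  have hM : 0 < M := hm.trans hmM
  set z := √(m / M) with hz
  have hz0 : 0 ≤ z := Real.sqrt_nonneg _
  have hz2 : z ^ 2 = m / M := Real.sq_sqrt (by positivity)
  have hz1 : z < 1 := by
    rw [hz, Real.sqrt_lt' one_pos, one_pow, div_lt_one hM]; exact hmM
  have hd : 0 < M - m := sub_pos.2 hmM
  have hc : Real.cosh (2 * Real.artanh z) = (M + m) / (M - m) := by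
    rw [cosh_two_mul_artanh hz0 hz1, hz2]; field_simp
  set D := (Chebyshev.T ℝ t).eval ((M + m) / (M - m)) with hD
  -- The image of 0 is cosh(2 artanh z), so T_t takes the value cosh(2t artanh z) there; then artanh
  -- z ≥ z and cosh x ≥ eˣ/2.
  have hDge : Real.exp (2 * t * z) / 2 ≤ D := by
    rw [hD, ← hc, Chebyshev.T_real_cosh, Real.cosh_eq]
    have h1 : 2 * t * z ≤ (t : ℤ) * (2 * Real.artanh z) := by
      have := mul_le_mul_of_nonneg_left (le_artanh hz0 hz1) (Nat.cast_nonneg (α := ℝ) t)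
      push_cast; linarith
    have h2 := Real.exp_le_exp.2 h1
    have h3 := Real.exp_pos (-((t : ℤ) * (2 * Real.artanh z)))
    linarith
  have hD0 : 0 < D := lt_of_lt_of_le (by positivity) hDge
  -- The affine map sends m to 1 and M to -1; dividing by D normalizes the value at 0.
  refine ⟨C D⁻¹ * (Chebyshev.T ℝ t).comp (C (-2 / (M - m)) * X + C ((M + m) / (M - m))), ?_, ?_, ?_⟩
  · refine (natDegree_C_mul_le _ _).trans (natDegree_comp_le.trans ?_)
    rw [Chebyshev.natDegree_T, Int.natAbs_natCast]
    exact (Nat.mul_le_mul_left t natDegree_linear_le).trans (mul_one t).le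
  · simp [eval_comp, ← hD, hD0.ne']
  · intro x hx1 hx2
    simp only [eval_mul, eval_C, eval_comp, eval_add, eval_X]
    rw [abs_mul, abs_of_pos (inv_pos.2 hD0)]
    have hT : |(Chebyshev.T ℝ t).eval (-2 / (M - m) * x + (M + m) / (M - m))| ≤ 1 := by
      apply Chebyshev.abs_eval_T_real_le_one
      rw [show -2 / (M - m) * x + (M + m) / (M - m) = (M + m - 2 * x) / (M - m) by ring,
        abs_le, le_div_iff₀ hd, div_le_iff₀ hd]
      constructor <;> linarith
    have hi : D⁻¹ ≤ 2 * Real.exp (-2 * t * z) := by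
      rw [inv_le_comm₀ hD0 (by positivity), show -2 * (t : ℝ) * z = -(2 * t * z) by ring,
        Real.exp_neg]
      refine le_trans (le_of_eq ?_) hDge
      field_simp
    calc _ ≤ D⁻¹ * 1 := by gcongr
      _ ≤ _ := by rwa [mul_one]

/-- A polynomial of degree at most `n` with a large value at `0` such that `(x - ε L) p(x) ^ 2` is
bounded on `[0, L]`. -/
theorem exists_polynomial_sub_mul_sq_le (n : ℕ) {ε L : ℝ} (hε : 0 < ε) (hε1 : ε < 1)
    (hL : 0 < L) :
    ∃ p : ℝ[X], p.natDegree ≤ n ∧ ∃ c : ℝ, 0 < c ∧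
      c * Real.sinh ((2 * n + 1) * √ε) ^ 2 ≤ ε * L * p.eval 0 ^ 2 ∧
      ∀ x, 0 ≤ x → x ≤ L → (x - ε * L) * p.eval x ^ 2 ≤ c := by
  have h1ε : 0 < 1 - ε := sub_pos.2 hε1
  set z := √ε with hz
  have hz0 : 0 ≤ z := Real.sqrt_nonneg _
  have hz2 : z ^ 2 = ε := Real.sq_sqrt hε.le
  have hz1 : z < 1 := by
    rw [hz, Real.sqrt_lt' one_pos, one_pow]; exact hε1
  have hc : Real.cosh (2 * Real.artanh z) = (1 + ε) / (1 - ε) := by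
    rw [cosh_two_mul_artanh hz0 hz1, hz2]
  -- The affine map sends ε L to 1, L to -1 and 0 to cosh(2 artanh √ε). To the left of ε L the
  -- factor x - ε L is nonpositive, so no bound on p is needed there.
  refine ⟨(chebyshevW n).comp (C (-2 / (L * (1 - ε))) * X + C ((1 + ε) / (1 - ε))), ?_,
    L * (1 - ε), by positivity, ?_, ?_⟩
  · refine natDegree_comp_le.trans ?_
    calc _ ≤ n * 1 := Nat.mul_le_mul (natDegree_chebyshevW_le n) natDegree_linear_le
      _ = n := mul_one n
  · have hW := eval_chebyshevW_cosh n (Real.artanh z)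
    have hs : Real.sinh (Real.artanh z) ^ 2 = ε / (1 - ε) := by
      rw [Real.sinh_artanh ⟨by linarith, hz1⟩, div_pow, hz2, Real.sq_sqrt h1ε.le]
    rw [hc] at hW
    have hmono : Real.sinh ((2 * n + 1) * z) ≤ Real.sinh ((2 * n + 1) * Real.artanh z) := by
      rw [Real.sinh_le_sinh]
      exact mul_le_mul_of_nonneg_left (le_artanh hz0 hz1) (by positivity)
    have hnn : 0 ≤ Real.sinh ((2 * n + 1) * z) := Real.sinh_nonneg_iff.2 (by positivity)
    simp only [eval_comp, eval_add, eval_mul, eval_C, eval_X, mul_zero, zero_add]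
    calc L * (1 - ε) * Real.sinh ((2 * n + 1) * z) ^ 2
        ≤ L * (1 - ε) * Real.sinh ((2 * n + 1) * Real.artanh z) ^ 2 := by gcongr
      _ = L * (1 - ε) * ((chebyshevW n).eval ((1 + ε) / (1 - ε)) ^ 2 * (ε / (1 - ε))) := by
        rw [← hW, mul_pow, hs]
      _ = ε * L * (chebyshevW n).eval ((1 + ε) / (1 - ε)) ^ 2 := by field_simp
      _ ≤ _ := le_rfl
  · intro x hx0 hxL
    simp only [eval_comp, eval_add, eval_mul, eval_C, eval_X]
    set y := -2 / (L * (1 - ε)) * x + (1 + ε) / (1 - ε) with hy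
    have hxy : x - ε * L = L * (1 - ε) / 2 * (1 - y) := by rw [hy]; field_simp; ring
    rcases le_or_gt x (ε * L) with hx | hx
    · exact (mul_nonpos_of_nonpos_of_nonneg (by linarith) (sq_nonneg _)).trans (by positivity)
    · have hp : 0 < L * (1 - ε) := by positivity
      have hy1 : y ≤ 1 := by
        by_contra hcon
        nlinarith
      have hy0 : -1 ≤ y := by
        by_contra hcon
        nlinarith
      have := one_sub_mul_eval_chebyshevW_sq_le n hy0 hy1
      rw [hxy, mul_assoc]
      calc _ ≤ L * (1 - ε) / 2 * 2 := by gcongr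
        _ = _ := by ring

/-! ### Symmetric operators, Krylov spans and optimality conditions on a ball -/

section Operator

variable {E : Type*} [NormedAddCommGroup E] [InnerProductSpace ℝ E]

/-- The quadratic `x ↦ ½ ⟪x, T x⟫ + ⟪b, x⟫`. -/
noncomputable def quadratic (T : E →ₗ[ℝ] E) (b x : E) : ℝ :=
  1 / 2 * inner ℝ x (T x) + inner ℝ b x

/-- The span of `b, T b, …, T ^ (t - 1) b`. -/
def krylovSpan (T : E →ₗ[ℝ] E) (b : E) (t : ℕ) : Submodule ℝ E :=
  Submodule.span ℝ {x | ∃ i : ℕ, i < t ∧ x = (T ^ i) b}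

theorem krylovSpan_mono (T : E →ₗ[ℝ] E) (b : E) : Monotone (krylovSpan T b) := by
  intro t u htu
  refine Submodule.span_mono ?_
  rintro x ⟨i, hi, rfl⟩
  exact ⟨i, hi.trans_le htu, rfl⟩

theorem self_mem_krylovSpan (T : E →ₗ[ℝ] E) (b : E) (t : ℕ) : b ∈ krylovSpan T b (t + 1) :=
  Submodule.subset_span ⟨0, t.succ_pos, by simp⟩

theorem apply_mem_krylovSpan (T : E →ₗ[ℝ] E) (b : E) {t : ℕ} {x : E}
    (hx : x ∈ krylovSpan T b t) : T x ∈ krylovSpan T b (t + 1) := by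
  have h : krylovSpan T b t ≤ (krylovSpan T b (t + 1)).comap T := by
    refine Submodule.span_le.2 ?_
    rintro y ⟨i, hi, rfl⟩
    exact Submodule.subset_span ⟨i + 1, by omega, by rw [pow_succ']; rfl⟩
  exact h hx

theorem aeval_mem_krylovSpan (T : E →ₗ[ℝ] E) (b : E) {t : ℕ} {q : ℝ[X]} (hq : q.natDegree < t) :
    aeval T q b ∈ krylovSpan T b t := by
  rw [aeval_eq_sum_range, LinearMap.sum_apply]
  refine Submodule.sum_mem _ fun i hi => ?_
  rw [Finset.mem_range] at hi
  exact Submodule.smul_mem _ _ (Submodule.subset_span ⟨i, by omega, rfl⟩)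

theorem isSymmetric_aeval {T : E →ₗ[ℝ] E} (hT : T.IsSymmetric) (q : ℝ[X]) :
    (aeval T q).IsSymmetric := by
  induction q using Polynomial.induction_on' with
  | add p q hp hq => rw [map_add]; exact hp.add hq
  | monomial n a =>
    intro x y
    rw [aeval_monomial]
    have h := hT.pow n x y
    simp only [Module.End.mul_apply, Module.algebraMap_end_apply, inner_smul_left,
      inner_smul_right, h, conj_trivial]

/-- A polynomial that is nonnegative on the eigenvalues of a symmetric operator gives a positive
semidefinite operator. -/
theorem inner_aeval_nonneg [FiniteDimensional ℝ E] {T : E →ₗ[ℝ] E} (hT : T.IsSymmetric) {q : ℝ[X]}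
    (hq : ∀ μ, Module.End.HasEigenvalue T μ → 0 ≤ q.eval μ) (x : E) :
    0 ≤ inner ℝ x (aeval T q x) := by
  set v := hT.eigenvectorBasis rfl
  rw [← v.sum_inner_mul_inner]
  refine Finset.sum_nonneg fun i _ => ?_
  have hv := hT.hasEigenvector_eigenvectorBasis rfl i
  rw [← isSymmetric_aeval hT q, Module.End.aeval_apply_of_hasEigenvector hv, inner_smul_left,
    conj_trivial, real_inner_comm x, mul_left_comm]
  exact mul_nonneg (hq _ (hT.hasEigenvalue_eigenvalues rfl i)) (mul_self_nonneg _)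

theorem quadratic_sub_quadratic {T : E →ₗ[ℝ] E} (hT : T.IsSymmetric) {b s : E} {lam : ℝ}
    (hs : T s + lam • s = -b) (x : E) :
    quadratic T b x - quadratic T b s =
      1 / 2 * (inner ℝ (x - s) (T (x - s)) + lam * ‖x - s‖ ^ 2) +
        lam / 2 * (‖s‖ ^ 2 - ‖x‖ ^ 2) := by
  have hb : b = -(T s + lam • s) := by rw [hs, neg_neg]
  have h1 : inner ℝ (T s) x = inner ℝ s (T x) := hT s x
  have h2 : inner ℝ (T s) s = inner ℝ s (T s) := hT s s
  have h3 : inner ℝ x (T s) = inner ℝ s (T x) := by rw [← h1, real_inner_comm]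
  simp only [quadratic, hb, map_sub, inner_sub_left, inner_sub_right, inner_neg_left,
    inner_add_left, inner_smul_left, ← real_inner_self_eq_norm_sq, conj_trivial, h1, h2, h3,
    real_inner_comm s x]
  ring

theorem quadratic_add {T : E →ₗ[ℝ] E} (hT : T.IsSymmetric) (b x y : E) :
    quadratic T b (x + y) =
      quadratic T b x + inner ℝ (T x + b) y + 1 / 2 * inner ℝ y (T y) := by
  have h1 : inner ℝ (T x) y = inner ℝ x (T y) := hT x y
  have h3 : inner ℝ y (T x) = inner ℝ x (T y) := by rw [← h1, real_inner_comm]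
  simp only [quadratic, map_add, inner_add_left, inner_add_right, h1, h3]
  ring

/-- First order optimality over a ball. -/
theorem inner_gradient_sub_nonneg {T : E →ₗ[ℝ] E} (hT : T.IsSymmetric) {b s : E} {R : ℝ}
    (hsR : ‖s‖ ≤ R) (hs : ∀ x, ‖x‖ ≤ R → quadratic T b s ≤ quadratic T b x) {x : E}
    (hx : ‖x‖ ≤ R) : 0 ≤ inner ℝ (T s + b) (x - s) := by
  by_contra! hneg
  set c := inner ℝ (T s + b) (x - s)
  set k := inner ℝ (x - s) (T (x - s)) with hk
  -- A step this short keeps the quadratic term below the negative linear one.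
  set τ := min 1 (-c / (|k| + 1)) with hτ
  have hk1 : 0 < |k| + 1 := by positivity
  have hτ0 : 0 < τ := lt_min one_pos (div_pos (by linarith) hk1)
  have hτ1 : τ ≤ 1 := min_le_left _ _
  have hτk : τ * (|k| + 1) ≤ -c := (le_div_iff₀ hk1).1 (min_le_right _ _)
  have hball : ‖s + τ • (x - s)‖ ≤ R := by
    have hmem := (convex_closedBall (0 : E) R).add_smul_sub_mem
      (mem_closedBall_zero_iff.2 hsR) (mem_closedBall_zero_iff.2 hx) ⟨hτ0.le, hτ1⟩
    exact mem_closedBall_zero_iff.1 hmem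
  have h := hs _ hball
  rw [quadratic_add hT, map_smul, inner_smul_right, inner_smul_left, inner_smul_right,
    conj_trivial, ← hk] at h
  have h2 : 0 ≤ τ * (c + τ * k / 2) := by linarith
  have h3 := nonneg_of_mul_nonneg_right h2 hτ0
  have h4 : τ * k ≤ τ * (|k| + 1) := by
    gcongr; linarith [le_abs_self k]
  linarith

/-- Testing first-order optimality at the ball point opposite to the gradient g forces equality in
Cauchy–Schwarz, so g = -(‖g‖/R) s and the multiplier is ‖g‖/R. -/
theorem exists_lagrange_multiplier {T : E →ₗ[ℝ] E} (hT : T.IsSymmetric) {b s : E} {R : ℝ}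
    (hR : 0 < R) (hsR : ‖s‖ ≤ R) (hs : ∀ x, ‖x‖ ≤ R → quadratic T b s ≤ quadratic T b x) :
    ∃ lam : ℝ, T s + lam • s = -b ∧ 0 ≤ lam ∧ lam * (R - ‖s‖) = 0 := by
  set g := T s + b with hg
  have hle : R * ‖g‖ ≤ -inner ℝ g s := by
    rcases eq_or_ne g 0 with h0 | h0
    · simp [h0]
    have hgp : 0 < ‖g‖ := norm_pos_iff.2 h0
    have h := inner_gradient_sub_nonneg hT hsR hs (x := -(R / ‖g‖) • g) (by
      rw [norm_smul, norm_neg, Real.norm_of_nonneg (by positivity), div_mul_cancel₀ _ hgp.ne'])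
    rw [← hg, inner_sub_right, inner_smul_right, real_inner_self_eq_norm_sq] at h
    have : R / ‖g‖ * ‖g‖ ^ 2 = R * ‖g‖ := by field_simp
    linarith
  have hcs : -inner ℝ g s ≤ ‖g‖ * ‖s‖ := (neg_le_abs _).trans (abs_real_inner_le_norm g s)
  have hgn := norm_nonneg g
  have hzero : g + (‖g‖ / R) • s = 0 := by
    rw [← norm_eq_zero, ← sq_eq_zero_iff]
    refine le_antisymm ?_ (sq_nonneg _)
    rw [norm_add_sq_real, inner_smul_right, norm_smul, Real.norm_of_nonneg (by positivity), mul_pow]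
    have h1 : ‖g‖ / R * inner ℝ g s ≤ ‖g‖ / R * (-(R * ‖g‖)) := by gcongr; linarith
    have h2 : (‖g‖ / R) ^ 2 * ‖s‖ ^ 2 ≤ (‖g‖ / R) ^ 2 * R ^ 2 := by gcongr
    have e1 : ‖g‖ / R * (-(R * ‖g‖)) = -‖g‖ ^ 2 := by field_simp
    have e2 : (‖g‖ / R) ^ 2 * R ^ 2 = ‖g‖ ^ 2 := by field_simp
    linarith
  refine ⟨‖g‖ / R, ?_, by positivity, ?_⟩
  · rw [← add_eq_zero_iff_eq_neg, ← hzero, hg]; abel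
  · have : ‖g‖ * (R - ‖s‖) = 0 :=
      le_antisymm (by linarith) (mul_nonneg hgn (sub_nonneg.2 hsR))
    rw [div_mul_eq_mul_div, this, zero_div]

/-- Second order optimality over a ball. -/
theorem neg_eigenvalue_le_multiplier {T : E →ₗ[ℝ] E} (hT : T.IsSymmetric) {b s u : E}
    {R lam l : ℝ} (hR : 0 < R) (hsR : ‖s‖ ≤ R)
    (hs : ∀ x, ‖x‖ ≤ R → quadratic T b s ≤ quadratic T b x) (hst : T s + lam • s = -b)
    (hc : lam * (R - ‖s‖) = 0) (hu : ‖u‖ = 1) (hTu : T u = l • u) : -l ≤ lam := by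
  have key : ∀ v : E, ‖s + v‖ = ‖s‖ → 0 ≤ inner ℝ v (T v) + lam * ‖v‖ ^ 2 := by
    intro v hv
    have h := quadratic_sub_quadratic hT hst (s + v)
    have h2 := hs (s + v) (hv ▸ hsR)
    rw [add_sub_cancel_left, hv] at h
    linarith
  have huu : inner ℝ u (T u) = l := by
    rw [hTu, inner_smul_right, real_inner_self_eq_norm_sq, hu]; ring
  by_contra! hneg
  rcases eq_or_lt_of_le hsR with hsR' | hsR'
  -- Reflecting `s` in the hyperplane orthogonal to v preserves its norm and displaces it by a
  -- nonzero multiple of v, so `key` applies in direction v.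
  · have refl : ∀ v : E, inner ℝ s v ≠ 0 → 0 ≤ inner ℝ v (T v) + lam * ‖v‖ ^ 2 := by
      intro v hv
      have hv0 : ‖v‖ ≠ 0 := by
        rintro h; rw [norm_eq_zero] at h; simp [h] at hv
      set c := -2 * inner ℝ s v / ‖v‖ ^ 2 with hcdef
      have hc0 : c ≠ 0 := by rw [hcdef]; positivity
      have h := key (c • v) (by
        rw [← sq_eq_sq₀ (norm_nonneg _) (norm_nonneg _), norm_add_sq_real, inner_smul_right,
          norm_smul, mul_pow, Real.norm_eq_abs, sq_abs, hcdef]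
        field_simp
        ring)
      rw [map_smul, inner_smul_left, inner_smul_right, norm_smul, mul_pow, Real.norm_eq_abs,
        sq_abs, conj_trivial] at h
      have h2 : 0 ≤ c ^ 2 * (inner ℝ v (T v) + lam * ‖v‖ ^ 2) := by linarith
      exact nonneg_of_mul_nonneg_right h2 (by positivity)
    -- If u is orthogonal to `s` the reflection is trivial, so u is tilted by a small δ • s whose
    -- effect cannot offset l + lam < 0.
    by_cases hsu : inner ℝ s u = 0
    · have hus : inner ℝ u s = 0 := by rw [real_inner_comm, hsu]
      have hss : inner ℝ s s = R ^ 2 := by rw [real_inner_self_eq_norm_sq, hsR']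
      have huTs : inner ℝ u (T s) = 0 := by
        rw [← hT, hTu, inner_smul_left, hus, mul_zero]
      set k := inner ℝ s (T s) + lam * R ^ 2 with hk
      set δ := √(-(l + lam) / (|k| + 1)) with hδ
      have hk1 : 0 < |k| + 1 := by positivity
      have hq : 0 < -(l + lam) / (|k| + 1) := div_pos (by linarith) hk1
      have hδ0 : 0 < δ := Real.sqrt_pos.2 hq
      have hδ2 : δ ^ 2 * (|k| + 1) = -(l + lam) := by
        rw [hδ, Real.sq_sqrt hq.le, div_mul_cancel₀ _ hk1.ne']
      have h := refl (u + δ • s) (by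
        rw [inner_add_right, inner_smul_right, hsu, hss]; positivity)
      rw [norm_add_sq_real, inner_smul_right, hus, hu, norm_smul, Real.norm_of_nonneg hδ0.le,
        hsR', map_add, map_smul, inner_add_left, inner_add_right, inner_add_right,
        inner_smul_left, inner_smul_left, inner_smul_right, inner_smul_right, huTs, huu, hTu,
        inner_smul_right, hsu, conj_trivial] at h
      have h2 : 0 ≤ l + lam + δ ^ 2 * k := by rw [hk]; linarith
      have h3 : δ ^ 2 * k < δ ^ 2 * (|k| + 1) := by
        gcongr; linarith [le_abs_self k]
      linarith
    · have h := refl u hsu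
      rw [huu, hu] at h
      linarith
  · have hl0 : lam = 0 := (mul_eq_zero.1 hc).resolve_right (sub_pos.2 hsR').ne'
    have h := quadratic_sub_quadratic hT hst (s + (R - ‖s‖) • u)
    have h2 := hs (s + (R - ‖s‖) • u) (by
      refine (norm_add_le _ _).trans ?_
      rw [norm_smul, hu, Real.norm_of_nonneg (sub_pos.2 hsR').le]; linarith)
    rw [add_sub_cancel_left, map_smul, inner_smul_left, inner_smul_right, huu, hl0,
      conj_trivial] at h
    have hp : 0 < (R - ‖s‖) ^ 2 := pow_pos (sub_pos.2 hsR') 2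
    nlinarith

end Operator

/-! ### Linear rate and approximate extremal eigenvectors -/

section Bounds

variable {E : Type*} [NormedAddCommGroup E] [InnerProductSpace ℝ E]

theorem inner_aeval_mul_sq {T : E →ₗ[ℝ] E} (hT : T.IsSymmetric) (r p : ℝ[X]) (x : E) :
    inner ℝ x (aeval T (r * p ^ 2) x) = inner ℝ (aeval T p x) (aeval T r (aeval T p x)) := by
  rw [show r * p ^ 2 = p * (r * p) by ring, map_mul, map_mul, Module.End.mul_apply,
    Module.End.mul_apply, ← isSymmetric_aeval hT p]

/-- Rescaling a vector close to `s` to the norm of `s` keeps it close to `s`, in every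
seminorm given by a positive semidefinite operator. -/
theorem inner_rescale_sub_le {S : E →ₗ[ℝ] E} (hS : ∀ x, 0 ≤ inner ℝ x (S x)) {s y : E} {ε : ℝ}
    (hs : s ≠ 0) (hε3 : ε ≤ 1 / 3) (h1 : ‖y - s‖ ≤ ε * ‖s‖)
    (h2 : inner ℝ (y - s) (S (y - s)) ≤ ε ^ 2 * inner ℝ s (S s)) :
    ∃ α : ℝ, ‖α • y‖ = ‖s‖ ∧
      inner ℝ (α • y - s) (S (α • y - s)) ≤ 9 * ε ^ 2 * inner ℝ s (S s) := by
  have hsp : 0 < ‖s‖ := norm_pos_iff.2 hs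
  have htri : |‖y‖ - ‖s‖| ≤ ε * ‖s‖ := (abs_norm_sub_norm_le y s).trans h1
  have hεs : ε * ‖s‖ ≤ 1 / 3 * ‖s‖ := by gcongr
  have hylow : 2 / 3 * ‖s‖ ≤ ‖y‖ := by linarith [(abs_le.1 htri).1]
  have hyp : 0 < ‖y‖ := by linarith
  set α := ‖s‖ / ‖y‖ with hα
  have hα0 : 0 < α := by positivity
  have hα1 : α ≤ 3 / 2 := by rw [hα, div_le_iff₀ hyp]; linarith
  have hαd : (α - 1) ^ 2 ≤ α ^ 2 * ε ^ 2 := by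
    rw [← mul_pow, ← sq_abs (α - 1)]
    have : |α - 1| ≤ α * ε := by
      rw [hα, div_sub_one hyp.ne', abs_div, abs_of_pos hyp, div_mul_eq_mul_div, abs_sub_comm]
      gcongr; linarith
    gcongr
  refine ⟨α, ?_, ?_⟩
  · rw [norm_smul, Real.norm_of_nonneg hα0.le, hα, div_mul_cancel₀ _ hyp.ne']
  -- Nonnegativity on the difference gives the bound ⟨v + w, S(v + w)⟩ ≤ 2⟨v, Sv⟩ + 2⟨w, Sw⟩. The
  -- constant 9 is then 4 α² with α ≤ 3/2.
  have hpar := hS (α • (y - s) - (α - 1) • s)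
  have e : α • y - s = α • (y - s) + (α - 1) • s := by module
  set d := y - s
  have hsum : inner ℝ (α • y - s) (S (α • y - s)) ≤
      2 * (α ^ 2 * inner ℝ d (S d)) + 2 * ((α - 1) ^ 2 * inner ℝ s (S s)) := by
    rw [e]
    simp only [map_add, map_sub, map_smul, inner_add_left, inner_add_right, inner_sub_left,
      inner_sub_right, inner_smul_left, inner_smul_right, conj_trivial] at hpar ⊢
    linarith
  have hss := hS s
  have hα2 : α ^ 2 ≤ 9 / 4 := by nlinarith
  calc _ ≤ 2 * (α ^ 2 * (ε ^ 2 * inner ℝ s (S s))) + 2 * (α ^ 2 * ε ^ 2 * inner ℝ s (S s)) := by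
        refine hsum.trans ?_
        gcongr
    _ = 4 * α ^ 2 * (ε ^ 2 * inner ℝ s (S s)) := by ring
    _ ≤ 4 * (9 / 4) * (ε ^ 2 * inner ℝ s (S s)) := by gcongr
    _ = _ := by ring

/-- Linear convergence of the Krylov subspace solutions. -/
theorem krylovSpan_linear_rate [FiniteDimensional ℝ E] {T : E →ₗ[ℝ] E} (hT : T.IsSymmetric)
    {b s st : E} {R l lam M : ℝ} {t : ℕ}
    (hlow : ∀ μ, Module.End.HasEigenvalue T μ → l ≤ μ)
    (hupp : ∀ μ, Module.End.HasEigenvalue T μ → μ + lam ≤ M)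
    (hst : T s + lam • s = -b) (hlam : 0 ≤ lam) (hpos : 0 < l + lam) (hlt : l + lam < M)
    (hsR : ‖s‖ ≤ R)
    (hmin : ∀ x ∈ krylovSpan T b t, ‖x‖ ≤ R → quadratic T b st ≤ quadratic T b x) :
    quadratic T b st - quadratic T b s ≤ 36 * (quadratic T b 0 - quadratic T b s) *
      Real.exp (-4 * t * √((l + lam) / M)) := by
  have hR : 0 ≤ R := (norm_nonneg s).trans hsR
  obtain ⟨p, hpdeg, hp0, hp⟩ := exists_polynomial_abs_le_exp t hpos hlt
  set ε := 2 * Real.exp (-2 * t * √((l + lam) / M)) with hε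
  have hε0 : 0 < ε := by positivity
  have hexp : 36 * Real.exp (-4 * t * √((l + lam) / M)) = 9 * ε ^ 2 := by
    rw [hε, mul_pow, ← Real.exp_nat_mul,
      show -4 * (t : ℝ) * √((l + lam) / M) = (2 : ℕ) * (-2 * t * √((l + lam) / M)) by
        push_cast; ring]
    ring
  rw [mul_right_comm, hexp]
  set r : ℝ[X] := X + C lam with hr
  have hrapp : ∀ x, aeval T r x = T x + lam • x := by intro x; simp [hr]
  have hreval : ∀ μ, r.eval μ = μ + lam := by intro μ; simp [hr]
  have hS : ∀ x, 0 ≤ inner ℝ x (aeval T r x) := fun x =>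
    inner_aeval_nonneg hT (fun μ hμ => by rw [hreval]; linarith [hlow μ hμ]) x
  have hid : ∀ x, quadratic T b x - quadratic T b s =
      1 / 2 * inner ℝ (x - s) (aeval T r (x - s)) + lam / 2 * (‖s‖ ^ 2 - ‖x‖ ^ 2) := by
    intro x
    rw [quadratic_sub_quadratic hT hst, hrapp, inner_add_right, inner_smul_right,
      real_inner_self_eq_norm_sq]
  have hgap : 1 / 2 * inner ℝ s (aeval T r s) ≤ quadratic T b 0 - quadratic T b s := by
    rw [hid 0, zero_sub, map_neg, inner_neg_neg, norm_zero]
    nlinarith [mul_nonneg hlam (sq_nonneg ‖s‖)]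
  have hgap0 : 0 ≤ quadratic T b 0 - quadratic T b s := by linarith [hS s]
  have h0le : quadratic T b st ≤ quadratic T b 0 := hmin 0 (zero_mem _) (by simpa using hR)
  rcases eq_or_ne s 0 with hs0 | hs0
  · rw [← hs0, sub_self, mul_zero]
    rw [← hs0] at h0le
    linarith
  -- For ε ≥ 1/3 the factor 9 ε² is at least 1, and comparison with the feasible point 0 suffices.
  rcases le_or_gt (1 / 3) ε with hε3 | hε3
  · have : 1 ≤ 9 * ε ^ 2 := by nlinarith
    nlinarith
  obtain ⟨q, hq⟩ : X ∣ 1 - p := by rw [X_dvd_iff, coeff_zero_eq_eval_zero]; simp [hp0]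
  have hpq : p = 1 - X * q := by rw [← hq]; ring
  set w := aeval T (p.comp r) s with hw
  -- Used with a = 1 for the norm and a = r for the seminorm of A + λ.
  have hbound : ∀ a : ℝ[X], (∀ μ, Module.End.HasEigenvalue T μ → 0 ≤ a.eval μ) →
      inner ℝ w (aeval T a w) ≤ ε ^ 2 * inner ℝ s (aeval T a s) := by
    intro a ha
    have h := inner_aeval_nonneg hT (q := a * C (ε ^ 2) - a * (p.comp r) ^ 2) (fun μ hμ => by
      have h1 := hp (μ + lam) (by linarith [hlow μ hμ]) (hupp μ hμ)
      have h2 : p.eval (μ + lam) ^ 2 ≤ ε ^ 2 := sq_le_sq' (by linarith [(abs_le.1 h1).1])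
        (abs_le.1 h1).2
      simp only [eval_sub, eval_mul, eval_C, eval_pow, eval_comp, hreval]
      have := mul_le_mul_of_nonneg_left h2 (ha μ hμ)
      linarith) s
    rw [map_sub, LinearMap.sub_apply, inner_sub_right, inner_aeval_mul_sq hT, ← hw,
      mul_comm a, map_mul, aeval_C, Module.End.mul_apply, Module.algebraMap_end_apply,
      inner_smul_right] at h
    linarith
  set y := -(aeval T (q.comp r) b) with hy
  have hws : s - w = y := by
    rw [hw, hy, hpq, sub_comp, mul_comp, X_comp, one_comp, map_sub, map_one, LinearMap.sub_apply,
      Module.End.one_apply, sub_sub_cancel, mul_comm, map_mul, Module.End.mul_apply, hrapp, hst,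
      map_neg]
  have hyK : y ∈ krylovSpan T b t := by
    rcases Nat.eq_zero_or_pos t with ht | ht
    · have hpc : p = 1 := by
        rw [eq_C_of_natDegree_le_zero (hpdeg.trans ht.le), coeff_zero_eq_eval_zero, hp0, C_1]
      have : y = 0 := by rw [← hws, hw, hpc]; simp
      rw [this]; exact zero_mem _
    refine neg_mem (aeval_mem_krylovSpan T b ?_)
    have hrd : r.natDegree = 1 := natDegree_X_add_C lam
    rw [natDegree_comp, hrd, mul_one]
    rcases eq_or_ne q 0 with h0 | h0
    · simpa [h0] using ht
    have h1 : (X * q).natDegree = q.natDegree + 1 := by rw [mul_comm, natDegree_mul_X h0]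
    have h2 : (1 - p).natDegree ≤ t := (natDegree_sub_le _ _).trans (by simpa using hpdeg)
    rw [hq, h1] at h2
    omega
  have hyw : y - s = -w := by rw [← hws]; abel
  have hn : ‖y - s‖ ≤ ε * ‖s‖ := by
    rw [hyw, norm_neg]
    have h := hbound 1 (fun μ _ => by simp)
    rw [map_one, Module.End.one_apply, Module.End.one_apply, real_inner_self_eq_norm_sq,
      real_inner_self_eq_norm_sq, ← mul_pow] at h
    exact (sq_le_sq₀ (norm_nonneg _) (by positivity)).1 h
  have hnS : inner ℝ (y - s) (aeval T r (y - s)) ≤ ε ^ 2 * inner ℝ s (aeval T r s) := by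
    rw [hyw, map_neg, inner_neg_neg]
    exact hbound r (fun μ hμ => by rw [hreval]; linarith [hlow μ hμ])
  obtain ⟨α, hα, hαS⟩ := inner_rescale_sub_le hS hs0 hε3.le hn hnS
  have hfin := hmin (α • y) (Submodule.smul_mem _ _ hyK) (hα.le.trans hsR)
  have hx := hid (α • y)
  rw [hα, sub_self, mul_zero, add_zero] at hx
  have : 9 * ε ^ 2 * (1 / 2 * inner ℝ s (aeval T r s)) ≤
    9 * ε ^ 2 * (quadratic T b 0 - quadratic T b s) := by gcongr
  linarith

/-- The Krylov subspace contains an approximate eigenvector for the smallest eigenvalue. -/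
theorem exists_mem_krylovSpan_inner_le [FiniteDimensional ℝ E] {T : E →ₗ[ℝ] E}
    (hT : T.IsSymmetric) {b u : E} {l L : ℝ} (n : ℕ)
    (hlow : ∀ μ, Module.End.HasEigenvalue T μ → l ≤ μ)
    (hupp : ∀ μ, Module.End.HasEigenvalue T μ → μ ≤ l + L) (hL : 0 < L)
    (hu : ‖u‖ = 1) (hTu : T u = l • u) (hub : inner ℝ u b ≠ 0) :
    ∃ z ∈ krylovSpan T b (n + 1), ‖z‖ = 1 ∧
      inner ℝ z (T z) - l ≤
        L * (Real.log (4 * ‖b‖ ^ 2 / inner ℝ u b ^ 2) / 2 / (2 * n + 1)) ^ 2 := by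
  set β := inner ℝ u b with hβ
  have hβ2 : 0 < β ^ 2 := by positivity
  have hb0 : b ≠ 0 := by rintro rfl; simp [hβ] at hub
  have hbp : 0 < ‖b‖ := norm_pos_iff.2 hb0
  have hcs : β ^ 2 ≤ ‖b‖ ^ 2 := by
    have := abs_real_inner_le_norm u b
    rw [hu, one_mul, ← hβ] at this
    rw [← sq_abs]; gcongr
  -- Chosen so that e^ell = 2‖b‖/|β|, hence |β| cosh ell ≥ ‖b‖; ε is then fixed by (2n + 1)√ε = ell.
  set ell := Real.log (4 * ‖b‖ ^ 2 / β ^ 2) / 2 with hell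
  have hell0 : 0 < ell := by
    refine div_pos (Real.log_pos ?_) two_pos
    rw [lt_div_iff₀ hβ2]; linarith
  set ε := (ell / (2 * n + 1)) ^ 2 with hε
  have hε0 : 0 < ε := by positivity
  have hsqrt : (2 * n + 1) * √ε = ell := by
    rw [hε, Real.sqrt_sq (by positivity)]; field_simp
  have normalize : ∀ w ∈ krylovSpan T b (n + 1), w ≠ 0 →
      inner ℝ w (T w) - l * ‖w‖ ^ 2 ≤ L * ε * ‖w‖ ^ 2 →
      ∃ z ∈ krylovSpan T b (n + 1), ‖z‖ = 1 ∧ inner ℝ z (T z) - l ≤ L * ε := by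
    intro w hw hw0 h
    have hwp : 0 < ‖w‖ := norm_pos_iff.2 hw0
    refine ⟨‖w‖⁻¹ • w, Submodule.smul_mem _ _ hw, ?_, ?_⟩
    · rw [norm_smul, norm_inv, norm_norm, inv_mul_cancel₀ hwp.ne']
    · rw [map_smul, inner_smul_left, inner_smul_right, conj_trivial]
      have : inner ℝ w (T w) ≤ (L * ε + l) * ‖w‖ ^ 2 := by linarith
      have h2 : ‖w‖⁻¹ * (‖w‖⁻¹ * inner ℝ w (T w)) ≤
          ‖w‖⁻¹ * (‖w‖⁻¹ * ((L * ε + l) * ‖w‖ ^ 2)) := by gcongr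
      have h3 : ‖w‖⁻¹ * (‖w‖⁻¹ * ((L * ε + l) * ‖w‖ ^ 2)) = L * ε + l := by field_simp
      linarith
  -- For ε ≥ 1 the claim allows the full spectral width L, so `b` itself works.
  rcases le_or_gt 1 ε with hε1 | hε1
  · refine normalize b (self_mem_krylovSpan T b n) hb0 ?_
    have h := inner_aeval_nonneg hT (q := C (l + L) - X)
      (fun μ hμ => by simpa using hupp μ hμ) b
    simp only [map_sub, aeval_C, aeval_X, LinearMap.sub_apply, Module.algebraMap_end_apply,
      inner_sub_right, inner_smul_right, real_inner_self_eq_norm_sq] at h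
    have : L * 1 * ‖b‖ ^ 2 ≤ L * ε * ‖b‖ ^ 2 := by gcongr
    linarith
  obtain ⟨p, hpdeg, c, hc, hp0, hp⟩ := exists_polynomial_sub_mul_sq_le n hε0 hε1 hL
  rw [hsqrt] at hp0
  set r : ℝ[X] := X - C l with hr
  set P := p.comp r with hP
  set a : ℝ[X] := C (ε * L) - r with ha
  set q := a * P ^ 2 with hq
  have hPeval : ∀ μ, P.eval μ = p.eval (μ - l) := by intro μ; simp [hP, hr, eval_comp]
  have hqeval : ∀ μ, q.eval μ = -((μ - l - ε * L) * p.eval (μ - l) ^ 2) := by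
    intro μ
    simp only [hq, ha, hr, eval_mul, eval_pow, hPeval, eval_sub, eval_C, eval_X]; ring
  have huvec : Module.End.HasEigenvector T l u :=
    ⟨Module.End.mem_eigenspace_iff.2 hTu, by rintro rfl; simp at hu⟩
  have haev : ∀ g : ℝ[X], aeval T g u = g.eval l • u := fun g =>
    Module.End.aeval_apply_of_hasEigenvector huvec
  set b' := b - β • u with hb'
  have hub' : inner ℝ u b' = 0 := by
    rw [hb', inner_sub_right, inner_smul_right, real_inner_self_eq_norm_sq, hu, ← hβ]; ring
  have hb'norm : ‖b'‖ ^ 2 = ‖b‖ ^ 2 - β ^ 2 := by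
    rw [hb', norm_sub_sq_real, inner_smul_right, real_inner_comm, ← hβ, norm_smul, hu, mul_one,
      Real.norm_eq_abs, sq_abs]; ring
  have hb'q : 0 ≤ inner ℝ b' (aeval T q b') + c * ‖b'‖ ^ 2 := by
    have h := inner_aeval_nonneg hT (q := q + C c) (fun μ hμ => by
      have := hp (μ - l) (by linarith [hlow μ hμ]) (by linarith [hupp μ hμ])
      rw [eval_add, eval_C, hqeval]; linarith) b'
    rw [map_add, aeval_C, LinearMap.add_apply, Module.algebraMap_end_apply, inner_add_right,
      inner_smul_right, real_inner_self_eq_norm_sq] at h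
    exact h
  have hsplit : inner ℝ b (aeval T q b) = β ^ 2 * q.eval l + inner ℝ b' (aeval T q b') := by
    have hbs : b = β • u + b' := by rw [hb']; abel
    have hz : inner ℝ u (aeval T q b') = 0 := by
      rw [← isSymmetric_aeval hT, haev, inner_smul_left, hub', mul_zero]
    rw [hbs, map_add, map_smul, haev, inner_add_left, inner_add_right, inner_add_right,
      inner_smul_left, inner_smul_left, inner_smul_right, inner_smul_right, inner_smul_right,
      inner_smul_right, hz, real_inner_comm u b', hub', real_inner_self_eq_norm_sq, hu,
      conj_trivial]
    ring
  have hql : q.eval l = ε * L * p.eval 0 ^ 2 := by rw [hqeval, sub_self]; ring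
  have hcosh : ‖b‖ ^ 2 ≤ β ^ 2 * Real.cosh ell ^ 2 := by
    have h1 : Real.exp ell / 2 ≤ Real.cosh ell := by
      rw [Real.cosh_eq]; linarith [Real.exp_pos (-ell)]
    have h2 : Real.exp ell ^ 2 = 4 * ‖b‖ ^ 2 / β ^ 2 := by
      rw [← Real.exp_nat_mul, hell, Nat.cast_ofNat, mul_div_cancel₀ _ two_ne_zero,
        Real.exp_log (by positivity)]
    calc ‖b‖ ^ 2 = β ^ 2 * (Real.exp ell / 2) ^ 2 := by rw [div_pow, h2]; field_simp; norm_num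
      _ ≤ _ := by gcongr
  -- The u-component contributes at least c β² sinh² ell and the rest at least -c(‖b‖² - β²); the
  -- sum is at least c(β² cosh² ell - ‖b‖²) ≥ 0.
  have hqb : 0 ≤ inner ℝ b (aeval T q b) := by
    rw [hsplit, hql]
    have h1 : β ^ 2 * (c * Real.sinh ell ^ 2) ≤ β ^ 2 * (ε * L * p.eval 0 ^ 2) := by gcongr
    have h2 : c * ‖b‖ ^ 2 ≤ c * (β ^ 2 * Real.cosh ell ^ 2) := by gcongr
    rw [Real.cosh_sq] at h2
    rw [hb'norm] at hb'q
    linarith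
  have hp00 : p.eval 0 ≠ 0 := by
    intro h
    have : 0 < c * Real.sinh ell ^ 2 := by
      have := Real.sinh_pos_iff.2 hell0
      positivity
    rw [h] at hp0
    linarith
  refine normalize (aeval T P b) (aeval_mem_krylovSpan T b ?_) ?_ ?_
  · rw [hP, natDegree_comp, hr, natDegree_X_sub_C, mul_one]; omega
  · intro h
    have h2 : inner ℝ u (aeval T P b) = p.eval 0 * β := by
      rw [← isSymmetric_aeval hT, haev, inner_smul_left, hPeval, sub_self, conj_trivial]
    rw [h, inner_zero_right] at h2
    exact mul_ne_zero hp00 hub h2.symm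
  · rw [hq, inner_aeval_mul_sq hT] at hqb
    simp only [ha, hr, map_sub, aeval_C, aeval_X, LinearMap.sub_apply,
      Module.algebraMap_end_apply, inner_sub_right, inner_smul_right,
      real_inner_self_eq_norm_sq] at hqb
    linarith

end Bounds

/-! ### Accelerated proximal gradient inside nested subspaces -/

section Accelerated

variable {E : Type*} [NormedAddCommGroup E] [InnerProductSpace ℝ E]

/-- The minimizer of `z ↦ μ / 2 ‖z‖ ^ 2 + c / 2 ‖z - v‖ ^ 2` over a ball is a multiple of `v`. -/
theorem exists_smul_prox {c μ R : ℝ} (hc : 0 < c) (hμ : 0 ≤ μ) (hR : 0 < R) (v : E) :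
    ∃ α : ℝ, ‖α • v‖ ≤ R ∧
      ∀ u, ‖u‖ ≤ R → 0 ≤ inner ℝ ((c + μ) • α • v - c • v) (u - α • v) := by
  have hcμ : 0 < c + μ := by linarith
  rcases le_or_gt (c / (c + μ) * ‖v‖) R with h | h
  · refine ⟨c / (c + μ), ?_, fun u _ => ?_⟩
    · rwa [norm_smul, Real.norm_of_nonneg (by positivity)]
    · rw [smul_smul, mul_div_cancel₀ _ hcμ.ne', sub_self, inner_zero_left]
  · have hv : 0 < ‖v‖ := by
      rcases (norm_nonneg v).eq_or_lt with h0 | h0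
      · rw [← h0, mul_zero] at h; linarith
      · exact h0
    refine ⟨R / ‖v‖, ?_, fun u hu => ?_⟩
    · rw [norm_smul, Real.norm_of_nonneg (by positivity), div_mul_cancel₀ _ hv.ne']
    · have hk : 0 ≤ c - (c + μ) * (R / ‖v‖) := by
        rw [div_mul_eq_mul_div, lt_div_iff₀ hcμ] at h
        rw [sub_nonneg, mul_div_assoc', div_le_iff₀ hv]
        linarith
      have hcs : inner ℝ v u ≤ ‖v‖ * R :=
        (real_inner_le_norm v u).trans (by gcongr)
      have e : (c + μ) • (R / ‖v‖) • v - c • v = -((c - (c + μ) * (R / ‖v‖)) • v) := by module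
      have e2 : R / ‖v‖ * ‖v‖ ^ 2 = ‖v‖ * R := by field_simp
      rw [e, inner_neg_left, inner_smul_left, conj_trivial, inner_sub_right, inner_smul_right,
        real_inner_self_eq_norm_sq, e2, ← mul_neg]
      exact mul_nonneg hk (by linarith)

theorem norm_sq_convex_comb_le (x z : E) {θ : ℝ} (h0 : 0 ≤ θ) (h1 : θ ≤ 1) :
    ‖(1 - θ) • x + θ • z‖ ^ 2 ≤ (1 - θ) * ‖x‖ ^ 2 + θ * ‖z‖ ^ 2 := by
  have h := mul_nonneg (mul_nonneg h0 (sub_nonneg.2 h1)) (sq_nonneg ‖x - z‖)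
  rw [norm_sub_sq_real] at h
  rw [norm_add_sq_real, inner_smul_left, inner_smul_right, norm_smul, norm_smul, conj_trivial,
    Real.norm_of_nonneg h0, Real.norm_of_nonneg (sub_nonneg.2 h1)]
  linarith

/-- One step of the accelerated proximal gradient method. -/
theorem accelerated_step {S : E →ₗ[ℝ] E} (hS : S.IsSymmetric) {b s x z z' : E} {L μ θ : ℝ}
    (hpos : ∀ x, 0 ≤ inner ℝ x (S x)) (hL : ∀ x, inner ℝ x (S x) ≤ L * ‖x‖ ^ 2)
    (hμ : 0 ≤ μ) (h0 : 0 ≤ θ) (h1 : θ ≤ 1)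
    (hz' : 0 ≤ inner ℝ
      (S ((1 - θ) • x + θ • z) + b + μ • z' + (θ * L) • (z' - z)) (s - z')) :
    quadratic S b ((1 - θ) • x + θ • z') + μ / 2 * ‖(1 - θ) • x + θ • z'‖ ^ 2 ≤
      (1 - θ) * (quadratic S b x + μ / 2 * ‖x‖ ^ 2) +
        θ * (quadratic S b s + μ / 2 * ‖s‖ ^ 2) +
        θ ^ 2 * (L / 2) * (‖z - s‖ ^ 2 - ‖z' - s‖ ^ 2) := by
  set y := (1 - θ) • x + θ • z with hy
  set g := S y + b with hg
  have hx' : (1 - θ) • x + θ • z' = y + θ • (z' - z) := by rw [hy]; module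
  have hlow : ∀ w, quadratic S b y + inner ℝ g (w - y) ≤ quadratic S b w := by
    intro w
    have h := quadratic_add hS b y (w - y)
    rw [add_sub_cancel] at h
    linarith [hpos (w - y)]
  have hq : quadratic S b ((1 - θ) • x + θ • z') ≤
      quadratic S b y + θ * inner ℝ g (z' - z) + θ ^ 2 * (L / 2) * ‖z' - z‖ ^ 2 := by
    rw [hx', quadratic_add hS, inner_smul_right, map_smul, inner_smul_left, inner_smul_right,
      conj_trivial]
    have := mul_le_mul_of_nonneg_left (hL (z' - z)) (sq_nonneg θ)
    linarith
  have hcomb : (1 - θ) * inner ℝ g (x - y) + θ * inner ℝ g (z - y) = 0 := by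
    rw [← inner_smul_right, ← inner_smul_right, ← inner_add_right,
      show (1 - θ) • (x - y) + θ • (z - y) = 0 by rw [hy]; module, inner_zero_right]
  have hprox : inner ℝ g (z' - s) ≤ μ / 2 * (‖s‖ ^ 2 - ‖z'‖ ^ 2) +
      θ * (L / 2) * (‖z - s‖ ^ 2 - ‖z' - s‖ ^ 2 - ‖z' - z‖ ^ 2) := by
    rw [inner_add_left, inner_add_left, inner_smul_left, inner_smul_left, conj_trivial,
      conj_trivial] at hz'
    have e1 : inner ℝ z' (s - z') ≤ 1 / 2 * (‖s‖ ^ 2 - ‖z'‖ ^ 2) := by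
      have := sq_nonneg ‖s - z'‖
      rw [norm_sub_sq_real, real_inner_comm] at this
      rw [inner_sub_right, real_inner_self_eq_norm_sq]
      linarith
    have e2 : inner ℝ (z' - z) (s - z') =
        1 / 2 * (‖z - s‖ ^ 2 - ‖z' - s‖ ^ 2 - ‖z' - z‖ ^ 2) := by
      have e : z - s = -((z' - z) + (s - z')) := by abel
      rw [e, norm_neg, norm_add_sq_real, norm_sub_rev z' s]
      ring
    have e3 : inner ℝ g (s - z') = -inner ℝ g (z' - s) := by
      rw [← inner_neg_right, neg_sub]
    have e4 := mul_le_mul_of_nonneg_left e1 hμ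
    rw [e2, e3] at hz'
    linarith
  have hsplit : inner ℝ g (z' - z) =
      inner ℝ g (z' - s) + inner ℝ g (s - y) - inner ℝ g (z - y) := by
    rw [← inner_add_right, ← inner_sub_right]
    congr 1
    abel
  have hn := mul_le_mul_of_nonneg_left (norm_sq_convex_comb_le x z' h0 h1) (div_nonneg hμ zero_le_two)
  have a1 := mul_le_mul_of_nonneg_left (hlow x) (sub_nonneg.2 h1)
  have a2 := mul_le_mul_of_nonneg_left (hlow s) h0
  have a3 := mul_le_mul_of_nonneg_left hprox h0
  rw [hsplit] at hq
  linarith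

/-- The accelerated proximal gradient method, run inside an increasing family of subspaces. -/
theorem exists_mem_accelerated {S : E →ₗ[ℝ] E} (hS : S.IsSymmetric) {b s : E} {L μ R : ℝ}
    (hpos : ∀ x, 0 ≤ inner ℝ x (S x)) (hL : ∀ x, inner ℝ x (S x) ≤ L * ‖x‖ ^ 2)
    (hL0 : 0 < L) (hμ : 0 ≤ μ) (hR : 0 < R) (hsR : ‖s‖ ≤ R)
    (hs : ∀ x, ‖x‖ ≤ R →
      quadratic S b s + μ / 2 * ‖s‖ ^ 2 ≤ quadratic S b x + μ / 2 * ‖x‖ ^ 2)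
    {K : ℕ → Submodule ℝ E} (hK : Monotone K) (hbK : ∀ k, b ∈ K (k + 1))
    (hSK : ∀ k, ∀ x ∈ K k, S x ∈ K (k + 1)) (k : ℕ) :
    ∃ x ∈ K k, ∃ z ∈ K k, ‖x‖ ≤ R ∧
      (k : ℝ) * (k + 2) / 4 * (quadratic S b x + μ / 2 * ‖x‖ ^ 2 -
        (quadratic S b s + μ / 2 * ‖s‖ ^ 2)) + L / 2 * ‖z - s‖ ^ 2 ≤ L / 2 * ‖s‖ ^ 2 := by
  induction k with
  | zero => exact ⟨0, zero_mem _, 0, zero_mem _, by simpa using hR.le, by simp⟩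
  | succ k ih =>
    obtain ⟨x, hx, z, hz, hxR, hinv⟩ := ih
    -- Multiplying the step inequality by θ⁻² = (k + 2)²/4 turns its factor 1 - θ into k(k + 2)/4,
    -- the current weight; the next weight (k + 1)(k + 3)/4 is smaller than θ⁻².
    set θ : ℝ := 2 / (k + 2) with hθ
    have hk2 : (0 : ℝ) < k + 2 := by positivity
    have hθ0 : 0 < θ := by positivity
    have hθ1 : θ ≤ 1 := by rw [hθ, div_le_one hk2]; linarith [Nat.cast_nonneg (α := ℝ) k]
    have hc : 0 < θ * L := by positivity
    set y := (1 - θ) • x + θ • z with hy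
    set v := z - (θ * L)⁻¹ • (S y + b) with hv
    obtain ⟨α, hαR, hα⟩ := exists_smul_prox hc hμ hR v
    have hyK : y ∈ K k := add_mem (Submodule.smul_mem _ _ hx) (Submodule.smul_mem _ _ hz)
    have hvK : v ∈ K (k + 1) := sub_mem (hK k.le_succ hz)
      (Submodule.smul_mem _ _ (add_mem (hSK k y hyK) (hbK k)))
    have hz'K : α • v ∈ K (k + 1) := Submodule.smul_mem _ _ hvK
    have hstep := accelerated_step hS (b := b) (s := s) (x := x) (z := z) (z' := α • v)
      hpos hL hμ hθ0.le hθ1 (by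
        have h := hα s hsR
        have e : (θ * L + μ) • α • v - (θ * L) • v =
            S y + b + μ • α • v + (θ * L) • (α • v - z) := by
          have e1 : (θ * L) • v = (θ * L) • z - (S y + b) := by
            rw [hv, smul_sub, smul_inv_smul₀ hc.ne']
          rw [e1]
          generalize α • v = w
          module
        rwa [e] at h)
    have hx'R : ‖(1 - θ) • x + θ • α • v‖ ≤ R := by
      have hmem := (convex_closedBall (0 : E) R) (mem_closedBall_zero_iff.2 hxR)
        (mem_closedBall_zero_iff.2 hαR) (sub_nonneg.2 hθ1) hθ0.le (sub_add_cancel 1 θ)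
      exact mem_closedBall_zero_iff.1 hmem
    refine ⟨(1 - θ) • x + θ • α • v,
      add_mem (Submodule.smul_mem _ _ (hK k.le_succ hx)) (Submodule.smul_mem _ _ hz'K),
      α • v, hz'K, hx'R, ?_⟩
    have hopt := hs _ hx'R
    set F' := quadratic S b ((1 - θ) • x + θ • α • v) + μ / 2 * ‖(1 - θ) • x + θ • α • v‖ ^ 2
    set F := quadratic S b x + μ / 2 * ‖x‖ ^ 2
    set Fs := quadratic S b s + μ / 2 * ‖s‖ ^ 2
    have h1 : (k + 2 : ℝ) ^ 2 / 4 * (F' - Fs) ≤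
        k * (k + 2) / 4 * (F - Fs) + L / 2 * (‖z - s‖ ^ 2 - ‖α • v - s‖ ^ 2) := by
      have h := mul_le_mul_of_nonneg_left (sub_le_sub_right hstep Fs)
        (by positivity : (0 : ℝ) ≤ (k + 2) ^ 2 / 4)
      refine h.trans (le_of_eq ?_)
      rw [hθ]
      field_simp
      ring
    have h2 : ((k + 1 : ℕ) : ℝ) * ((k + 1 : ℕ) + 2) / 4 * (F' - Fs) ≤
        (k + 2 : ℝ) ^ 2 / 4 * (F' - Fs) := by
      refine mul_le_mul_of_nonneg_right ?_ (sub_nonneg.2 hopt)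
      push_cast
      linarith
    linarith

end Accelerated

/-! ### Sublinear rate -/

section Sublinear

variable {E : Type*} [NormedAddCommGroup E] [InnerProductSpace ℝ E]

/-- A line through a point of a ball meets the bounding sphere on either side of the point. -/
theorem exists_norm_add_smul_eq {x z : E} {R : ℝ} (hx : ‖x‖ ≤ R) (hz : ‖z‖ = 1) (c : ℝ) :
    ∃ α : ℝ, ‖x + α • z‖ = R ∧ α ^ 2 ≤ (2 * R) ^ 2 ∧ α * c ≤ 0 := by
  have hR : 0 ≤ R := (norm_nonneg x).trans hx
  have hx2 : ‖x‖ ^ 2 ≤ R ^ 2 := by gcongr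
  set k := inner ℝ x z with hk
  -- The two intersection parameters are ±r - k; they have opposite signs (weakly), so one of them
  -- makes the linear term nonpositive.
  set r := √(k ^ 2 + (R ^ 2 - ‖x‖ ^ 2)) with hr
  have hr2 : r ^ 2 = k ^ 2 + (R ^ 2 - ‖x‖ ^ 2) :=
    Real.sq_sqrt (add_nonneg (sq_nonneg _) (sub_nonneg.2 hx2))
  have hkr : |k| ≤ r := Real.abs_le_sqrt (by linarith)
  have hsphere : ∀ α : ℝ, (α + k) ^ 2 = r ^ 2 → ‖x + α • z‖ = R ∧ α ^ 2 ≤ (2 * R) ^ 2 := by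
    intro α hα
    have h1 : ‖x + α • z‖ = R := by
      rw [← sq_eq_sq₀ (norm_nonneg _) hR, norm_add_sq_real, inner_smul_right, norm_smul, hz,
        mul_one, Real.norm_eq_abs, sq_abs, ← hk]
      linarith
    refine ⟨h1, ?_⟩
    have h2 : |α| ≤ 2 * R := by
      calc |α| = ‖(x + α • z) - x‖ := by
            rw [add_sub_cancel_left, norm_smul, hz, mul_one, Real.norm_eq_abs]
        _ ≤ ‖x + α • z‖ + ‖x‖ := norm_sub_le _ _
        _ ≤ 2 * R := by linarith
    rw [← sq_abs]
    gcongr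
  rcases le_total c 0 with hc | hc
  · have h := hsphere (r - k) (by ring)
    exact ⟨r - k, h.1, h.2,
      mul_nonpos_of_nonneg_of_nonpos (by linarith [(abs_le.1 hkr).2]) hc⟩
  · have h := hsphere (-r - k) (by ring)
    exact ⟨-r - k, h.1, h.2,
      mul_nonpos_of_nonpos_of_nonneg (by linarith [(abs_le.1 hkr).1]) hc⟩

/-- The accelerated rate for a quadratic, where only the spread `L` of the spectrum enters. -/
theorem exists_mem_krylovSpan_accelerated [FiniteDimensional ℝ E] {T : E →ₗ[ℝ] E}
    (hT : T.IsSymmetric) {b s : E} {l L μ R : ℝ} {t : ℕ} (ht : 0 < t)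
    (hlow : ∀ ν, Module.End.HasEigenvalue T ν → l ≤ ν)
    (hupp : ∀ ν, Module.End.HasEigenvalue T ν → ν ≤ l + L) (hL : 0 < L)
    (hμ : 0 ≤ μ) (hR : 0 < R) (hsR : ‖s‖ ≤ R)
    (hs : ∀ x, ‖x‖ ≤ R → quadratic T b s + (μ - l) / 2 * ‖s‖ ^ 2 ≤
      quadratic T b x + (μ - l) / 2 * ‖x‖ ^ 2) :
    ∃ x ∈ krylovSpan T b t, ‖x‖ ≤ R ∧
      quadratic T b x + (μ - l) / 2 * ‖x‖ ^ 2 - (quadratic T b s + (μ - l) / 2 * ‖s‖ ^ 2) ≤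
        2 * (L * ‖s‖ ^ 2 / ((t : ℝ) - 1 / 2) ^ 2) := by
  set S : E →ₗ[ℝ] E := aeval T (X - C l) with hSdef
  have hSapp : ∀ x, S x = T x - l • x := by intro x; simp [hSdef]
  have hSinner : ∀ x, inner ℝ x (S x) = inner ℝ x (T x) - l * ‖x‖ ^ 2 := by
    intro x
    rw [hSapp, inner_sub_right, inner_smul_right, real_inner_self_eq_norm_sq]
  have hpos : ∀ x, 0 ≤ inner ℝ x (S x) := fun x =>
    inner_aeval_nonneg hT (fun ν hν => by simpa using hlow ν hν) x
  have hLS : ∀ x, inner ℝ x (S x) ≤ L * ‖x‖ ^ 2 := by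
    intro x
    have h := inner_aeval_nonneg hT (q := C (l + L) - X) (fun ν hν => by simpa using hupp ν hν) x
    simp only [map_sub, aeval_C, aeval_X, LinearMap.sub_apply, Module.algebraMap_end_apply,
      inner_sub_right, inner_smul_right, real_inner_self_eq_norm_sq] at h
    rw [hSinner]
    linarith
  have hF : ∀ x, quadratic S b x + μ / 2 * ‖x‖ ^ 2 =
      quadratic T b x + (μ - l) / 2 * ‖x‖ ^ 2 := by
    intro x
    rw [quadratic, quadratic, hSinner]
    ring
  obtain ⟨x, hxK, z, -, hxR, hinv⟩ := exists_mem_accelerated (isSymmetric_aeval hT _) (b := b)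
    (s := s) hpos hLS hL hμ hR hsR (fun x hx => by rw [hF, hF]; exact hs x hx)
    (krylovSpan_mono T b) (self_mem_krylovSpan T b) (fun k x hx => by
      rw [hSapp]
      exact sub_mem (apply_mem_krylovSpan T b hx)
        (Submodule.smul_mem _ _ (krylovSpan_mono T b k.le_succ hx))) t
  rw [hF, hF] at hinv
  refine ⟨x, hxK, hxR, ?_⟩
  have hopt := hs x hxR
  set D := quadratic T b x + (μ - l) / 2 * ‖x‖ ^ 2 - (quadratic T b s + (μ - l) / 2 * ‖s‖ ^ 2)
    with hD
  have hD0 : 0 ≤ D := sub_nonneg.2 hopt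
  have ht1 : (1 : ℝ) ≤ t := by exact_mod_cast ht
  have hden : 0 < ((t : ℝ) - 1 / 2) ^ 2 := pow_pos (by linarith) 2
  rw [mul_div_assoc', le_div_iff₀ hden]
  have h1 : D * ((t : ℝ) - 1 / 2) ^ 2 ≤ D * (t * (t + 2)) :=
    mul_le_mul_of_nonneg_left (by nlinarith) hD0
  have h2 : 0 ≤ L / 2 * ‖z - s‖ ^ 2 := by positivity
  linarith

/-- Sublinear convergence of the Krylov subspace solutions. -/
theorem krylovSpan_sublinear_rate [FiniteDimensional ℝ E] {T : E →ₗ[ℝ] E}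
    (hT : T.IsSymmetric) {b s st u : E} {l L lam R : ℝ} {t : ℕ} (ht : 0 < t)
    (hlow : ∀ ν, Module.End.HasEigenvalue T ν → l ≤ ν)
    (hupp : ∀ ν, Module.End.HasEigenvalue T ν → ν ≤ l + L) (hL : 0 < L) (hR : 0 < R)
    (hsR : ‖s‖ ≤ R) (hs : ∀ x, ‖x‖ ≤ R → quadratic T b s ≤ quadratic T b x)
    (hst : T s + lam • s = -b) (hlam : -l ≤ lam) (hc : lam * (R - ‖s‖) = 0)
    (hmin : ∀ x ∈ krylovSpan T b t, ‖x‖ ≤ R → quadratic T b st ≤ quadratic T b x)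
    (hu : ‖u‖ = 1) (hTu : T u = l • u) (hub : l < 0 → inner ℝ u b ≠ 0) :
    quadratic T b st - quadratic T b s ≤ L * ‖s‖ ^ 2 / ((t : ℝ) - 1 / 2) ^ 2 *
      (4 + (if l < 0 then (1 : ℝ) else 0) / 8 *
        Real.log (4 * ‖b‖ ^ 2 / inner ℝ u b ^ 2) ^ 2) := by
  have ht1 : (1 : ℝ) ≤ t := by exact_mod_cast ht
  have hB : 0 ≤ L * ‖s‖ ^ 2 / ((t : ℝ) - 1 / 2) ^ 2 := by positivity
  split_ifs with hl
  · have hlam0 : lam ≠ 0 := by linarith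
    have hsR' : ‖s‖ = R := by
      linarith [(mul_eq_zero.1 hc).resolve_left hlam0]
    have hS : ∀ x, 0 ≤ inner ℝ x (T x) - l * ‖x‖ ^ 2 := by
      intro x
      have h := inner_aeval_nonneg hT (q := X - C l) (fun ν hν => by simpa using hlow ν hν) x
      simpa [inner_sub_right, inner_smul_right] using h
    -- Taking μ = 0 treats f - (l/2)‖x‖², which `s` also minimizes over the ball because λ + l ≥ 0
    -- and ‖s‖ = R.
    obtain ⟨x, hxK, hxR, hx⟩ := exists_mem_krylovSpan_accelerated hT ht hlow hupp hL le_rfl hR hsR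
      (b := b) (s := s) (fun x hx => by
        have h := quadratic_sub_quadratic hT hst x
        have h1 := hS (x - s)
        have h2 : 0 ≤ (lam + l) * (‖s‖ ^ 2 - ‖x‖ ^ 2) := by
          refine mul_nonneg (by linarith) (sub_nonneg.2 ?_)
          rw [hsR']; gcongr
        have h3 : 0 ≤ (lam + l) * ‖x - s‖ ^ 2 := mul_nonneg (by linarith) (sq_nonneg _)
        linarith)
    obtain ⟨n, rfl⟩ : ∃ n, t = n + 1 := ⟨t - 1, by omega⟩
    obtain ⟨z, hzK, hz, hzl⟩ :=
      exists_mem_krylovSpan_inner_le hT n hlow hupp hL hu hTu (hub hl)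
    set lg := Real.log (4 * ‖b‖ ^ 2 / inner ℝ u b ^ 2)
    -- The last argument is the slope along z of the convexified function at x, so reaching the
    -- sphere costs only the curvature term.
    obtain ⟨α, hα, hα2, hαc⟩ :=
      exists_norm_add_smul_eq hxR hz (inner ℝ (T x + b) z - l * inner ℝ x z)
    have hfin := hmin (x + α • z) (add_mem hxK (Submodule.smul_mem _ _ hzK)) hα.le
    have hexp := quadratic_add hT b x (α • z)
    have hnorm : R ^ 2 = ‖x‖ ^ 2 + 2 * (α * inner ℝ x z) + α ^ 2 := by
      rw [← hα, norm_add_sq_real, inner_smul_right, norm_smul, hz, mul_one, Real.norm_eq_abs,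
        sq_abs]
    rw [inner_smul_right, map_smul, inner_smul_left, inner_smul_right, conj_trivial] at hexp
    have hz0 := hS z
    rw [hz] at hz0
    have hcurv : α ^ 2 * (inner ℝ z (T z) - l) ≤
        (2 * R) ^ 2 * (L * (lg / 2 / (2 * n + 1)) ^ 2) :=
      mul_le_mul hα2 hzl (by linarith) (sq_nonneg _)
    -- Here t = n + 1, so (2n + 1)/2 = t - 1/2; this is the source of the shift and of the factor
    -- 1/8.
    have e : 1 / 2 * ((2 * R) ^ 2 * (L * (lg / 2 / (2 * n + 1)) ^ 2)) =
        L * ‖s‖ ^ 2 / (((n + 1 : ℕ) : ℝ) - 1 / 2) ^ 2 * (1 / 8 * lg ^ 2) := by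
      rw [hsR']
      have h1 : ((n + 1 : ℕ) : ℝ) - 1 / 2 = (2 * n + 1) / 2 := by push_cast; ring
      rw [h1]
      field_simp
      ring
    have hlR : l * ‖s‖ ^ 2 = l * (‖x‖ ^ 2 + 2 * (α * inner ℝ x z) + α ^ 2) := by rw [hsR', hnorm]
    generalize L * ‖s‖ ^ 2 / (((n + 1 : ℕ) : ℝ) - 1 / 2) ^ 2 = B at *
    rw [mul_add]
    linarith
  · push Not at hl
    obtain ⟨x, hxK, hxR, hx⟩ := exists_mem_krylovSpan_accelerated hT ht hlow hupp hL hl hR hsR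
      (b := b) (s := s) (fun x hx => by simpa using hs x hx)
    have hfin := hmin x hxK hxR
    rw [sub_self, zero_div, zero_mul, zero_mul, add_zero, add_zero] at hx
    rw [zero_div, zero_mul, add_zero]
    linarith

end Sublinear

/-! ### Transfer to matrices and conclusion -/

theorem krylov_eq_krylovSpan {d : ℕ} (A : Matrix (Fin d) (Fin d) ℝ)
    (b : EuclideanSpace ℝ (Fin d)) (t : ℕ) :
    krylov A b t = krylovSpan (Matrix.toEuclideanLin A) b t := by
  simp only [krylov, krylovSpan, Matrix.toLpLin_pow]

theorem quad_eq_quadratic {d : ℕ} (A : Matrix (Fin d) (Fin d) ℝ)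
    (b x : EuclideanSpace ℝ (Fin d)) :
    quad A b x = quadratic (Matrix.toEuclideanLin A) b x := rfl

theorem toEuclideanLin_add_smul_one_apply {d : ℕ} (A : Matrix (Fin d) (Fin d) ℝ) (lam : ℝ)
    (s : EuclideanSpace ℝ (Fin d)) :
    Matrix.toEuclideanLin (A + lam • (1 : Matrix (Fin d) (Fin d) ℝ)) s =
      Matrix.toEuclideanLin A s + lam • s := by
  rw [map_add, map_smul, Matrix.toLpLin_one, LinearMap.add_apply, LinearMap.smul_apply,
    LinearMap.id_apply]

end TrustRegion

theorem theorem1 {d : ℕ} (A : Matrix (Fin d) (Fin d) ℝ) (hA : A.IsSymm)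
    (b : EuclideanSpace ℝ (Fin d)) (R : ℝ) (hR : 0 < R) (lmin lmax : ℝ)
    (hmin : IsLeast (TrustRegion.eigenvalueSet A) lmin)
    (hmax : IsGreatest (TrustRegion.eigenvalueSet A) lmax)
    (s : EuclideanSpace ℝ (Fin d)) (hs : TrustRegion.IsSolution A b R s) :
    ∃ lam : ℝ, TrustRegion.IsMultiplier A b R lmin s lam ∧
      (∀ lam' : ℝ, TrustRegion.IsMultiplier A b R lmin s lam' → lam' = lam) ∧
      ∀ t : ℕ, 0 < t → ∀ st : EuclideanSpace ℝ (Fin d),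
        TrustRegion.IsKrylovSolution A b R t st →
        TrustRegion.quad A b st - TrustRegion.quad A b s ≤
            36 * (TrustRegion.quad A b 0 - TrustRegion.quad A b s) *
              Real.exp (-4 * (t : ℝ) * Real.sqrt ((lmin + lam) / (lmax + lam))) ∧
        ∀ umin : EuclideanSpace ℝ (Fin d), ‖umin‖ = 1 →
          Matrix.toEuclideanLin A umin = lmin • umin →
          (lmin < 0 → inner ℝ umin b ≠ 0) →
          TrustRegion.quad A b st - TrustRegion.quad A b s ≤
            (lmax - lmin) * ‖s‖ ^ 2 / ((t : ℝ) - 1 / 2) ^ 2 *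
              (4 + (if lmin < 0 then (1 : ℝ) else 0) / 8 *
                Real.log (4 * ‖b‖ ^ 2 / (inner ℝ umin b) ^ 2) ^ 2) := by
  have hT : (Matrix.toEuclideanLin A).IsSymmetric := by
    rw [Matrix.isSymmetric_toEuclideanLin_iff, Matrix.IsHermitian,
      Matrix.conjTranspose_eq_transpose_of_trivial]
    exact hA
  have hlow : ∀ ν, Module.End.HasEigenvalue (Matrix.toEuclideanLin A) ν → lmin ≤ ν :=
    fun ν hν => hmin.2 hν
  have hupp : ∀ ν, Module.End.HasEigenvalue (Matrix.toEuclideanLin A) ν → ν ≤ lmax :=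
    fun ν hν => hmax.2 hν
  have hll : lmin ≤ lmax := hlow _ hmax.1
  have hopt : ∀ x, ‖x‖ ≤ R → TrustRegion.quadratic (Matrix.toEuclideanLin A) b s ≤
      TrustRegion.quadratic (Matrix.toEuclideanLin A) b x := hs.le_of_norm_le
  obtain ⟨lam, hst, hlam0, hcomp⟩ :=
    TrustRegion.exists_lagrange_multiplier hT hR hs.norm_le hopt
  have hlam : -lmin ≤ lam := by
    obtain ⟨v, hv⟩ := hmin.1.exists_hasEigenvector
    have hv0 : ‖v‖ ≠ 0 := norm_ne_zero_iff.2 hv.2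
    refine TrustRegion.neg_eigenvalue_le_multiplier hT hR hs.norm_le hopt hst hcomp
      (u := ‖v‖⁻¹ • v) ?_ ?_
    · rw [norm_smul, norm_inv, norm_norm, inv_mul_cancel₀ hv0]
    · rw [map_smul, hv.apply_eq_smul, smul_comm]
  refine ⟨lam, ⟨?_, max_le hlam hlam0, hcomp⟩, ?_, ?_⟩
  · rw [TrustRegion.toEuclideanLin_add_smul_one_apply, hst]
  · intro lam' h'
    have h1 := h'.stationary
    rw [TrustRegion.toEuclideanLin_add_smul_one_apply, ← hst, add_right_inj] at h1
    rcases eq_or_ne s 0 with h0 | h0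
    · have h2 := h'.complementary
      rw [h0, norm_zero, sub_zero] at h2 hcomp
      rw [(mul_eq_zero.1 h2).resolve_right hR.ne', (mul_eq_zero.1 hcomp).resolve_right hR.ne']
    · exact smul_left_injective ℝ h0 h1
  intro t ht st hK
  have hKmin : ∀ x ∈ TrustRegion.krylovSpan (Matrix.toEuclideanLin A) b t, ‖x‖ ≤ R →
      TrustRegion.quadratic (Matrix.toEuclideanLin A) b st ≤
        TrustRegion.quadratic (Matrix.toEuclideanLin A) b x := by
    rw [← TrustRegion.krylov_eq_krylovSpan]
    exact hK.le_of_mem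
  simp only [TrustRegion.quad_eq_quadratic]
  refine ⟨?_, fun u hu hTu hub => ?_⟩
  -- When λ_min + λ = 0 the exponential is 1 and the bound follows from f(st) ≤ f(0).
  · rcases (by linarith : 0 ≤ lmin + lam).eq_or_lt with h0 | hpos
    · have h1 := hKmin 0 (zero_mem _) (by simpa using hR.le)
      have h2 := hopt 0 (by simpa using hR.le)
      rw [← h0, zero_div, Real.sqrt_zero, mul_zero, Real.exp_zero]
      linarith
    -- The rate lemmas need a spectral interval of positive length. Enlarging it and letting the
    -- endpoint decrease to its true value covers λ_min = λ_max; the second bound uses the same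
    -- limit.
    · have hM : lmax + lam ≠ 0 := by linarith
      refine ge_of_tendsto (f := fun M => 36 *
          (TrustRegion.quadratic (Matrix.toEuclideanLin A) b 0 -
            TrustRegion.quadratic (Matrix.toEuclideanLin A) b s) *
          Real.exp (-4 * (t : ℝ) * Real.sqrt ((lmin + lam) / M)))
        (x := nhdsWithin (lmax + lam) (Set.Ioi (lmax + lam))) ?_ ?_
      · refine Filter.Tendsto.mono_left (ContinuousAt.tendsto ?_) nhdsWithin_le_nhds
        fun_prop (disch := assumption)
      · filter_upwards [self_mem_nhdsWithin] with M hM'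
        rw [Set.mem_Ioi] at hM'
        exact TrustRegion.krylovSpan_linear_rate hT hlow
          (fun ν hν => by linarith [hupp ν hν]) hst hlam0 hpos (by linarith) hs.norm_le hKmin
  · refine ge_of_tendsto (f := fun L : ℝ => L * ‖s‖ ^ 2 / ((t : ℝ) - 1 / 2) ^ 2 *
        (4 + (if lmin < 0 then (1 : ℝ) else 0) / 8 *
          Real.log (4 * ‖b‖ ^ 2 / (inner ℝ u b) ^ 2) ^ 2))
      (x := nhdsWithin (lmax - lmin) (Set.Ioi (lmax - lmin))) ?_ ?_
    · refine Filter.Tendsto.mono_left (Continuous.tendsto ?_ _) nhdsWithin_le_nhds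
      fun_prop
    · filter_upwards [self_mem_nhdsWithin] with L hL
      rw [Set.mem_Ioi] at hL
      exact TrustRegion.krylovSpan_sublinear_rate hT ht hlow
        (fun ν hν => by linarith [hupp ν hν]) (by linarith) hR hs.norm_le hopt hst hlam hcomp
        hKmin hu hTu hub
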